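/- Here a unital $*$-algebra is a unital associative $\mathbb{C}$-algebra $A$ with an additive map $*\colon A\to A$ satisfying $a^{**}=a$, $(ab)^*=b^*a^*$ and $(\alpha a)^*=\overline{\alpha}a^*$ for all $a,b\in A$, $\alpha\in\mathbb{C}$. A unitary representation of $A$ is a complex Hilbert space $V$ with a (unital, left) $A$-module structure, extending its structure of complex vector space, such that $\langle au,v\rangle=\langle u,a^*v\rangle$ for all $a\in A$ and $u,v\in V$; it is irreducible if $V\neq 0$ and $V$ has no closed $A$-submodules other than $0$ and $V$, and faithful if $aV=0$ implies $a=0$. Write $\operatorname{Jac}(A)$ for the Jacobson radical of $A$; it is stable under $*$, so that $A/\operatorname{Jac}(A)$ is again a unital $*$-algebra. For $m\geq 0$ let $$S_m(x_1,\dots,x_m)=\sum_{\sigma}\operatorname{sgn}(\sigma)\,x_{\sigma(1)}\cdots x_{\sigma(m)}\in\mathbb{Z}\langle x_1,\dots,x_m\rangle ,$$ where $\sigma$ runs over all permutations of $\{1,\dots,m\}$, be the standard polynomial in $m$ non-commuting variables; it is a polynomial identity of a ring $R$ if it vanishes for all $x_1,\dots,x_m\in R$. **Proposition.** Let $A$ be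 a unital $*$-algebra and let $n\geq 0$ be an integer. Consider the conditions: (a$'$) every irreducible unitary representation of $A$ has $\mathbb{C}$-dimension at most $n$; (b) $S_{2n}$ is a polynomial identity of $A/\operatorname{Jac}(A)$. Then (b) implies (a$'$). If moreover $A/\operatorname{Jac}(A)$ admits a faithful unitary representation, then (a$'$) implies (b). -/

import Mathlib

universe u v w

/-! ### The standard polynomials and polynomial identities -/

/-- The standard polynomial `S_m(x_1, …, x_m) = ∑_σ sgn(σ) x_{σ(1)} ⋯ x_{σ(m)}` in the ring
`ℤ⟨x_1, …, x_m⟩` of polynomials in `m` non-commuting variables. -/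
noncomputable def standardPolynomial (m : ℕ) : FreeAlgebra ℤ (Fin m) :=
  ∑ σ : Equiv.Perm (Fin m),
    ((Equiv.Perm.sign σ : ℤˣ) : ℤ) • (List.ofFn fun i => FreeAlgebra.ι ℤ (σ i)).prod

/-- A non-commutative integral polynomial `f` is an identity of the ring `R` if it vanishes under
every substitution of elements of `R` for its variables. -/
def IsPolynomialIdentity {X : Type*} (f : FreeAlgebra ℤ X) (R : Type*) [Ring R] : Prop :=
  ∀ x : X → R, FreeAlgebra.lift ℤ x f = 0

/-! ### Unitary representations of unital `*`-algebras -/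

/-- A unitary representation of a unital `*`-algebra `A` on `V` (a complex Hilbert space wherever
this is used): an `A`-module structure on the vector space `V`, i.e. a unital algebra homomorphism
to the linear endomorphisms, such that `⟪a u, v⟫ = ⟪u, a* v⟫`. -/
structure UnitaryRep (A : Type u) [Ring A] [StarRing A] [Algebra ℂ A]
    (V : Type v) [NormedAddCommGroup V] [InnerProductSpace ℂ V] where
  /-- The action of the algebra on the vector space. -/
  toHom : A →ₐ[ℂ] Module.End ℂ V
  inner_map_left : ∀ (a : A) (x y : V), inner ℂ (toHom a x) y = inner ℂ x (toHom (star a) y)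

namespace UnitaryRep

variable {A : Type u} [Ring A] [StarRing A] [Algebra ℂ A]
  {V : Type v} [NormedAddCommGroup V] [InnerProductSpace ℂ V]

/-- Topological irreducibility: the space is nonzero, and there is no closed `A`-submodule besides
zero and the whole space. -/
structure IsIrreducible (ρ : UnitaryRep A V) : Prop where
  nontrivial : Nontrivial V
  eq_bot_or_eq_top : ∀ W : Submodule ℂ V, IsClosed (W : Set V) →
    (∀ (a : A), ∀ x ∈ W, ρ.toHom a x ∈ W) → W = ⊥ ∨ W = ⊤

/-- A representation is faithful if only `0 : A` acts as zero. -/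
def IsFaithful (ρ : UnitaryRep A V) : Prop :=
  Function.Injective ρ.toHom

end UnitaryRep

/-! ### The `*`-algebra `A / Jac(A)` -/

section JacobsonStar

theorem Ring.isUnit_one_add_of_mem_jacobson {R : Type*} [Ring R] {x : R}
    (hx : x ∈ Ring.jacobson R) : IsUnit (1 + x) := by
  have key : ∀ y ∈ Ring.jacobson R, ∃ z, z * (1 + y) = 1 := by
    intro y hy
    rw [← Ideal.jacobson_bot, Ideal.mem_jacobson_iff] at hy
    obtain ⟨z, hz⟩ := hy 1
    refine ⟨z, ?_⟩
    rw [Submodule.mem_bot, mul_one, sub_eq_zero] at hz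
    rw [mul_add, mul_one, add_comm, hz]
  obtain ⟨z, hz⟩ := key x hx
  obtain ⟨w, hw⟩ := key (-(z * x)) (neg_mem (Ideal.mul_mem_left _ z hx))
  have hz' : 1 + -(z * x) = z := by
    rw [← hz, mul_add, mul_one]; abel
  rw [hz'] at hw
  have hwx : w = 1 + x := left_inv_eq_right_inv hw hz
  exact ⟨⟨1 + x, z, by rw [← hwx, hw], hz⟩, rfl⟩

theorem Ring.star_mem_jacobson {A : Type*} [Ring A] [StarRing A] {x : A}
    (hx : x ∈ Ring.jacobson A) : star x ∈ Ring.jacobson A := by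
  rw [← Ideal.jacobson_bot, Ideal.mem_jacobson_iff]
  intro y
  have h : IsUnit (1 + x * star y) :=
    Ring.isUnit_one_add_of_mem_jacobson (Ideal.mul_mem_right _ _ hx)
  obtain ⟨z, hz⟩ := h.star.exists_left_inv
  refine ⟨z, ?_⟩
  rw [star_add, star_one, star_mul, star_star] at hz
  rw [Submodule.mem_bot, ← hz]
  noncomm_ring

/-- The involution `(a + Jac(A))* = a* + Jac(A)`. -/
instance jacobsonQuotientStar {A : Type*} [Ring A] [StarRing A] :
    Star (A ⧸ Ring.jacobson A) where
  star := QuotientAddGroup.map _ _ (starAddEquiv : A ≃+ A).toAddMonoidHom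
    (fun _ hx => Ring.star_mem_jacobson hx)

theorem star_mk_jacobson {A : Type*} [Ring A] [StarRing A] (a : A) :
    star (Ideal.Quotient.mk (Ring.jacobson A) a) = Ideal.Quotient.mk (Ring.jacobson A) (star a) :=
  rfl

instance jacobsonQuotientStarRing {A : Type*} [Ring A] [StarRing A] :
    StarRing (A ⧸ Ring.jacobson A) where
  star_involutive := by
    intro x
    obtain ⟨a, rfl⟩ := Ideal.Quotient.mk_surjective x
    rw [star_mk_jacobson, star_mk_jacobson, star_star]
  star_mul := by
    intro x y
    obtain ⟨a, rfl⟩ := Ideal.Quotient.mk_surjective x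
    obtain ⟨b, rfl⟩ := Ideal.Quotient.mk_surjective y
    rw [← map_mul, star_mk_jacobson, star_mk_jacobson, star_mk_jacobson, star_mul, map_mul]
  star_add := by
    intro x y
    obtain ⟨a, rfl⟩ := Ideal.Quotient.mk_surjective x
    obtain ⟨b, rfl⟩ := Ideal.Quotient.mk_surjective y
    rw [← map_add, star_mk_jacobson, star_mk_jacobson, star_mk_jacobson, star_add, map_add]

instance jacobsonQuotientStarModule {A : Type*} [Ring A] [StarRing A] [Algebra ℂ A]
    [StarModule ℂ A] : StarModule ℂ (A ⧸ Ring.jacobson A) where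
  star_smul := by
    intro r x
    obtain ⟨a, rfl⟩ := Ideal.Quotient.mk_surjective x
    change Ideal.Quotient.mk _ (star (r • a)) = _
    rw [star_smul]
    rfl

end JacobsonStar

/-! ### Matrices with vanishing traces of powers -/

/-! (b) implies (a'). Unitary operators of this kind are bounded by the closed graph theorem, so an
irreducible representation maps `A` to the C*-algebra of bounded operators on `V`. Such a map kills
the radical: if x is in Jac(A), the image of x*x has spectrum {0}, hence norm 0. So `S_{2n}`
vanishes on the image of `A`. By Schur's lemma on finite direct sums the image is strongly dense,
and multilinearity carries the identity to all bounded operators. Matrix units e₀₀, e₀₁, e₁₁, ...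
along n + 1 orthonormal vectors violate it, so the dimension is at most n.

(a') implies (b). If a value s of `S_{2n}` is nonzero in the quotient, a faithful representation
gives a state f with f(s*s) > 0. The states obeying the same operator bounds form a compact convex
set, so an extreme one also has f(s*s) > 0. Its GNS representation is irreducible and does not kill
s. But it has dimension at most n, so the Amitsur–Levitzki theorem kills s.

Amitsur–Levitzki is proved by Rosset's method: for X = ∑ Aᵢ eᵢ with exterior variables eᵢ, the
coefficients of X^(2n) are the entries of `S_{2n}(A)`, while X² has commuting entries and powers of
trace zero, so Cayley–Hamilton makes it nilpotent. -/

theorem Matrix.derivative_det {ι R : Type*} [Fintype ι] [DecidableEq ι] [CommRing R]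
    (M : Matrix ι ι (Polynomial R)) :
    Polynomial.derivative M.det = (M.adjugate * M.map Polynomial.derivative).trace := by
  have h : ∀ i, (M.adjugate * M.map Polynomial.derivative) i i =
      (M.updateCol i fun j => Polynomial.derivative (M j i)).det := by
    intro i
    rw [← Matrix.cramer_apply, Matrix.cramer_eq_adjugate_mulVec]
    rfl
  simp only [Matrix.trace, Matrix.diag_apply, h, Matrix.det_apply', map_sum]
  rw [Finset.sum_comm]
  refine Finset.sum_congr rfl fun σ _ => ?_
  rw [Polynomial.derivative_intCast_mul, Polynomial.derivative_prod_finset, Finset.mul_sum]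
  refine Finset.sum_congr rfl fun i _ => ?_
  rw [← Finset.mul_prod_erase _ _ (Finset.mem_univ i)]
  congr 1
  rw [mul_comm, Matrix.updateCol_self]
  congr 1
  refine Finset.prod_congr rfl fun j hj => ?_
  rw [Matrix.updateCol_ne (Finset.ne_of_mem_erase hj)]

/-- Jacobi's formula replaces Newton's identities. Nilpotency makes the geometric series for (1 -
tY)⁻¹ finite, so the derivative of det(1 - tY) is a multiple of a sum of terms t^j tr(Y^(j+1)). It
vanishes, and without additive torsion the determinant is constant, equal to its value 1 at t = 0.
-/
theorem Matrix.charpolyRev_eq_one_of_trace_pow_eq_zero {ι R : Type*} [Fintype ι] [DecidableEq ι]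
    [CommRing R] [IsAddTorsionFree R] {Y : Matrix ι ι R} (hY : IsNilpotent Y)
    (htr : ∀ k, (Y ^ (k + 1)).trace = 0) : Y.charpolyRev = 1 := by
  obtain ⟨N, hN⟩ := hY
  set Z : Matrix ι ι (Polynomial R) := (Polynomial.X : Polynomial R) • Y.map Polynomial.C with hZ
  have hpow : ∀ k, Z ^ k = (Polynomial.X ^ k : Polynomial R) • (Y ^ k).map Polynomial.C := by
    intro k
    rw [hZ, smul_pow, Matrix.map_pow]
  have hinv : (1 - Z) * ∑ j ∈ Finset.range N, Z ^ j = 1 := by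
    rw [mul_neg_geom_sum, hpow, hN]
    simp
  have hadj : (1 - Z).adjugate = (1 - Z).det • ∑ j ∈ Finset.range N, Z ^ j := by
    calc (1 - Z).adjugate = (1 - Z).adjugate * ((1 - Z) * ∑ j ∈ Finset.range N, Z ^ j) := by
          rw [hinv, mul_one]
      _ = _ := by rw [← mul_assoc, Matrix.adjugate_mul, smul_mul_assoc, one_mul]
  have hder : (1 - Z).map Polynomial.derivative = -Y.map Polynomial.C := by
    ext1 i j
    by_cases hij : i = j <;> simp [hZ, hij]
  have hd : Polynomial.derivative Y.charpolyRev = 0 := by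
    change Polynomial.derivative (1 - Z).det = 0
    rw [Matrix.derivative_det, hadj, hder, mul_neg, Matrix.trace_neg, smul_mul_assoc,
      Matrix.trace_smul, Finset.sum_mul, Matrix.trace_sum, Finset.sum_eq_zero, smul_zero, neg_zero]
    intro j _
    rw [hpow, smul_mul_assoc, ← Matrix.map_mul, ← pow_succ, Matrix.trace_smul]
    have : ((Y ^ (j + 1)).map Polynomial.C).trace = Polynomial.C (Y ^ (j + 1)).trace := by
      simp [Matrix.trace]
    rw [this, htr, map_zero, smul_zero]
  rw [Polynomial.eq_C_of_natDegree_eq_zero (Polynomial.derivative_eq_zero.1 hd),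
    Polynomial.coeff_zero_eq_eval_zero,
    Matrix.eval_charpolyRev, Polynomial.C_1]

theorem Matrix.pow_card_eq_zero_of_trace_pow_eq_zero {ι R : Type*} [Fintype ι] [DecidableEq ι]
    [CommRing R] [IsAddTorsionFree R] {Y : Matrix ι ι R} (hY : IsNilpotent Y)
    (htr : ∀ k, (Y ^ (k + 1)).trace = 0) : Y ^ Fintype.card ι = 0 := by
  nontriviality R
  have h1 := Matrix.charpolyRev_eq_one_of_trace_pow_eq_zero hY htr
  have hchar : Y.charpoly = Polynomial.X ^ Fintype.card ι := by
    ext k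
    rw [Polynomial.coeff_X_pow]
    -- Below the top degree, coefficient k is the coefficient of positive index `card ι - k` in the
    -- reversed polynomial 1.
    rcases lt_trichotomy k (Fintype.card ι) with hk | hk | hk
    · have := congrArg (fun p => Polynomial.coeff p (Fintype.card ι - k)) h1
      simp only [← Matrix.reverse_charpoly, Polynomial.coeff_reverse,
        Matrix.charpoly_natDegree_eq_dim] at this
      rw [Polynomial.revAt_le (Nat.sub_le _ _), Nat.sub_sub_self hk.le, Polynomial.coeff_one,
        if_neg (by omega)] at this
      rw [this, if_neg hk.ne]
    · rw [if_pos hk, hk, ← Matrix.charpoly_natDegree_eq_dim Y]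
      exact Y.charpoly_monic
    · rw [if_neg hk.ne', Polynomial.coeff_eq_zero_of_natDegree_lt]
      rwa [Matrix.charpoly_natDegree_eq_dim]
  have := Matrix.aeval_self_charpoly Y
  rwa [hchar, map_pow, Polynomial.aeval_X] at this

/-! ### Evaluating the standard polynomials -/

theorem lift_standardPolynomial {R : Type*} [Ring R] {m : ℕ} (x : Fin m → R) :
    FreeAlgebra.lift ℤ x (standardPolynomial m) =
      ∑ σ : Equiv.Perm (Fin m), ((Equiv.Perm.sign σ : ℤˣ) : ℤ) •
        (List.ofFn fun i => x (σ i)).prod := by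
  simp [standardPolynomial, map_list_prod, List.map_ofFn, Function.comp_def]

theorem map_lift_standardPolynomial {R S : Type*} [Ring R] [Ring S] (f : R →+* S) {m : ℕ}
    (x : Fin m → R) :
    f (FreeAlgebra.lift ℤ x (standardPolynomial m)) =
      FreeAlgebra.lift ℤ (fun i => f (x i)) (standardPolynomial m) := by
  simp [lift_standardPolynomial, map_list_prod, List.map_ofFn, Function.comp_def]

theorem IsPolynomialIdentity.of_injective {R S : Type*} [Ring R] [Ring S] (f : R →+* S)
    (hf : Function.Injective f) {m : ℕ} (h : IsPolynomialIdentity (standardPolynomial m) S) :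
    IsPolynomialIdentity (standardPolynomial m) R := fun x =>
  hf (by rw [map_lift_standardPolynomial, h, map_zero])

/-! ### The Amitsur–Levitzki theorem -/

namespace AmitsurLevitzki

open ExteriorAlgebra

variable {K : Type*} [Field K] {V : Type*} [AddCommGroup V] [Module K V]

theorem ι_mul_comm (u v : V) : ι K u * ι K v = -(ι K v * ι K u) :=
  eq_neg_of_add_eq_zero_left (ι_add_mul_swap u v)

theorem commute_ι_mul_ι (u v w : V) : Commute (ι K u * ι K v) (ι K w) := by
  rw [Commute, SemiconjBy, mul_assoc, ι_mul_comm v w, mul_neg, ← mul_assoc, ι_mul_comm u w,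
    neg_mul, neg_neg, mul_assoc]

variable (K V) in
/-- The products of pairs of degree-one elements, which generate the even part. -/
def evenGenerators : Set (ExteriorAlgebra K V) :=
  {z | ∃ u v : V, z = ι K u * ι K v}

theorem evenGenerators_comm :
    ∀ a ∈ evenGenerators K V, ∀ b ∈ evenGenerators K V, a * b = b * a := by
  rintro _ ⟨u, v, rfl⟩ _ ⟨w, z, rfl⟩
  exact (commute_ι_mul_ι u v w).mul_right (commute_ι_mul_ι u v z)

theorem commute_ι_of_mem_adjoin {z : ExteriorAlgebra K V}
    (hz : z ∈ Algebra.adjoin K (evenGenerators K V)) (w : V) : Commute z (ι K w) := by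
  induction hz using Algebra.adjoin_induction with
  | mem x hx => obtain ⟨u, v, rfl⟩ := hx; exact commute_ι_mul_ι u v w
  | algebraMap r => exact Algebra.commutes r _
  | add x y _ _ hx hy => exact hx.add_left hy
  | mul x y _ _ hx hy => exact hx.mul_left hy

/-- The square of a matrix with entries of degree one has even entries; here it is as a matrix over
the commutative ring of even elements. -/
noncomputable def evenSquare {ι' : Type*} [Fintype ι'] (B : Matrix ι' ι' V) :
    Matrix ι' ι' (Algebra.adjoin K (evenGenerators K V)) :=
  Matrix.of fun p q => ∑ r, ⟨ι K (B p r) * ι K (B r q), Algebra.subset_adjoin ⟨_, _, rfl⟩⟩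

variable {ι' : Type*} [Fintype ι'] [DecidableEq ι']

theorem map_evenSquare (B : Matrix ι' ι' V) :
    (evenSquare B).map (Algebra.adjoin K (evenGenerators K V)).val = B.map (ι K) ^ 2 := by
  ext p q
  simp [evenSquare, sq, Matrix.mul_apply]

theorem map_evenSquare_pow (B : Matrix ι' ι' V) (k : ℕ) :
    (evenSquare B ^ k).map (Algebra.adjoin K (evenGenerators K V)).val = B.map (ι K) ^ (2 * k) := by
  rw [pow_mul, ← map_evenSquare]
  exact map_pow (Algebra.adjoin K (evenGenerators K V)).val.toRingHom.mapMatrix (evenSquare B) k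

/-- Write the power as X(XZ) and as (XZ)X with Z = X^(2k). Entries of Z commute with those of X,
while entries of X anticommute, so cyclically permuting the trace changes its sign. -/
theorem trace_pow_eq_zero [CharZero K] (B : Matrix ι' ι' V) (k : ℕ) :
    (B.map (ι K) ^ (2 * (k + 1))).trace = 0 := by
  set X := B.map (ι K)
  set Z := X ^ (2 * k) with hZ
  have hcomm : ∀ p q w, Commute (Z p q) (ι K w) := by
    intro p q w
    rw [hZ, ← map_evenSquare_pow]
    exact commute_ι_of_mem_adjoin (Subtype.prop _) w
  have h1 : X ^ (2 * (k + 1)) = X * (X * Z) := by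
    rw [← mul_assoc, ← sq, ← pow_add]; congr 1; ring
  have h2 : X ^ (2 * (k + 1)) = (X * Z) * X := by
    rw [mul_assoc, ← pow_succ, ← pow_succ']; congr 1
  have h3 : (X ^ (2 * (k + 1))).trace = -(X ^ (2 * (k + 1))).trace := by
    conv_lhs => rw [h1]
    conv_rhs => rw [h2]
    simp only [Matrix.trace, Matrix.diag_apply, Matrix.mul_apply, Finset.mul_sum, Finset.sum_mul]
    rw [← Finset.sum_neg_distrib, Finset.sum_comm]
    refine Finset.sum_congr rfl fun p _ => ?_
    rw [← Finset.sum_neg_distrib]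
    refine Finset.sum_congr rfl fun q _ => ?_
    rw [← Finset.sum_neg_distrib]
    refine Finset.sum_congr rfl fun r _ => ?_
    change ι K (B q p) * (ι K (B p r) * Z r q) = -(ι K (B p r) * Z r q * ι K (B q p))
    rw [mul_assoc (ι K (B p r)), (hcomm r q _).eq, ← mul_assoc, ← mul_assoc, ι_mul_comm, neg_mul]
  have h4 : (2 : K) • (X ^ (2 * (k + 1))).trace = 0 := by
    rw [two_smul]; nth_rewrite 1 [h3]; exact neg_add_cancel _
  exact (smul_eq_zero.1 h4).resolve_left two_ne_zero

/-- Cayley–Hamilton is available for the square of the odd matrix, not for the matrix itself. The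
commutative ring `R` stands for the even subalgebra, whose commutative structure is built in the
next lemma. -/
theorem pow_two_mul_card_eq_zero_of_ringHom [CharZero K] {R : Type*} [CommRing R]
    [IsAddTorsionFree R] (φ : R →+* ExteriorAlgebra K V) (hφ : Function.Injective φ)
    (Y : Matrix ι' ι' R) (B : Matrix ι' ι' V) (hY : φ.mapMatrix Y = B.map (ι K) ^ 2)
    (hB : IsNilpotent (B.map (ι K))) : B.map (ι K) ^ (2 * Fintype.card ι') = 0 := by
  have hinj : Function.Injective (φ.mapMatrix : Matrix ι' ι' R →+* _) := Matrix.map_injective hφ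
  have hpow : ∀ k, φ.mapMatrix (Y ^ k) = B.map (ι K) ^ (2 * k) := fun k => by
    rw [map_pow, hY, pow_mul]
  have hnil : IsNilpotent Y := by
    obtain ⟨N, hN⟩ := hB
    refine ⟨N, hinj ?_⟩
    rw [hpow, mul_comm, pow_mul, hN, map_zero, zero_pow two_ne_zero]
  have := Matrix.pow_card_eq_zero_of_trace_pow_eq_zero hnil fun k => hφ <| by
    rw [map_zero, ← trace_pow_eq_zero (K := K) B k, ← hpow, AddMonoidHom.map_trace]
    rfl
  rw [← hpow, this, map_zero]

theorem pow_two_mul_card_eq_zero [CharZero K] (B : Matrix ι' ι' V)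
    (hB : IsNilpotent (B.map (ι K))) : B.map (ι K) ^ (2 * Fintype.card ι') = 0 := by
  let E := Algebra.adjoin K (evenGenerators K V)
  have := Algebra.isMulCommutative_adjoin K (evenGenerators_comm (K := K) (V := V))
  let _ : CommRing E :=
    { (inferInstance : Ring E) with mul_comm := fun a b => this.is_comm.comm a b }
  have : IsAddTorsionFree E := IsAddTorsionFree.of_isTorsionFree K _
  exact pow_two_mul_card_eq_zero_of_ringHom (R := E) E.val.toRingHom Subtype.val_injective
    (evenSquare B) B (map_evenSquare B) hB

theorem list_prod_smul {α : Type*} (A : α → Matrix ι' ι' K) (e : α → V) (L : List α) :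
    (L.map fun i => (Matrix.of fun p q => ι K (A i p q • e i) :
        Matrix ι' ι' (ExteriorAlgebra K V))).prod =
      Matrix.of fun p q => (L.map A).prod p q • (L.map fun i => ι K (e i)).prod := by
  induction L with
  | nil => ext p q; by_cases h : p = q <;> simp [h]
  | cons i L ih =>
    rw [List.map_cons, List.prod_cons, ih]
    ext p q
    simp only [List.map_cons, List.prod_cons, Matrix.mul_apply, Matrix.of_apply, map_smul,
      smul_mul_smul_comm, Finset.sum_smul]

theorem sum_pow {R : Type*} [Ring R] {m : ℕ} {α : Type*} [Fintype α] (D : α → R) :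
    (∑ i, D i) ^ m = ∑ f : Fin m → α, (List.ofFn fun j => D (f j)).prod := by
  classical
  have := (MultilinearMap.mkPiAlgebraFin ℤ m R).map_sum (fun (_ : Fin m) => D)
  simpa using this

theorem map_ι_pow {α : Type*} [Fintype α] (A : α → Matrix ι' ι' K) (e : α → V) (m : ℕ) :
    ((Matrix.of fun p q => ∑ i, A i p q • e i).map (ι K)) ^ m =
      ∑ f : Fin m → α, Matrix.of fun p q =>
        (List.ofFn fun j => A (f j)).prod p q • ιMulti K m fun j => e (f j) := by
  have h : (Matrix.of fun p q => ∑ i, A i p q • e i).map (ι K) =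
      ∑ i, (Matrix.of fun p q => ι K (A i p q • e i) : Matrix ι' ι' (ExteriorAlgebra K V)) := by
    ext p q
    simp [Matrix.sum_apply]
  rw [h, sum_pow]
  refine Finset.sum_congr rfl fun f _ => ?_
  have := list_prod_smul A e (List.ofFn f)
  rwa [List.map_ofFn, List.map_ofFn, List.map_ofFn] at this

theorem ιMulti_single_ne_zero (m : ℕ) :
    ιMulti K m (fun j => (Pi.single j 1 : Fin m → K)) ≠ 0 := by
  intro h
  have h2 := liftAlternating_apply_ιMulti (R := K) (N := K)
    -- The determinant in degree m, and zero in every other degree, induces a functional on the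
    -- exterior algebra that is 1 on the wedge of the standard basis.
    (fun i => if hi : i = m then hi ▸ (Matrix.detRowAlternating (R := K) (n := Fin m)) else 0)
    (fun j => (Pi.single j 1 : Fin m → K))
  rw [h, map_zero] at h2
  simp only [dite_true] at h2
  have h3 : Matrix.det (Matrix.of fun j => (Pi.single j 1 : Fin m → K)) = 1 := by
    convert Matrix.det_one (R := K) (n := Fin m)
    ext i j
    simp [Matrix.one_apply, Pi.single_apply, eq_comm]
  exact zero_ne_one (h2.trans h3)

/-- Words with a repeated letter vanish in the exterior algebra; the remaining ones are
permutations, and sorting their wedge produces the sign. -/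
theorem map_ι_pow_fin {m : ℕ} (A : Fin m → Matrix ι' ι' K) (p q : ι') :
    (((Matrix.of fun p q => ∑ i, A i p q • (Pi.single i 1 : Fin m → K)).map (ι K)) ^ m) p q =
      (∑ σ : Equiv.Perm (Fin m), ((Equiv.Perm.sign σ : ℤˣ) : ℤ) •
        (List.ofFn fun i => A (σ i)).prod) p q • ιMulti K m fun j => (Pi.single j 1 : Fin m → K) := by
  rw [map_ι_pow, Matrix.sum_apply, Matrix.sum_apply, Finset.sum_smul]
  symm
  refine Finset.sum_of_injOn (fun σ : Equiv.Perm (Fin m) => (σ : Fin m → Fin m))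
    (fun _ _ _ _ h => DFunLike.coe_injective h) (fun _ _ => Finset.mem_coe.2 (Finset.mem_univ _))
    (fun f _ hf => ?_) (fun σ _ => ?_)
  · have hf' : ¬ Function.Injective f := fun hinj => hf
      ⟨Equiv.ofBijective f (Finite.injective_iff_bijective.1 hinj), by simp, rfl⟩
    rw [Matrix.of_apply, ιMulti_eq_zero_of_not_inj, smul_zero]
    exact fun hinj => hf' (Function.Injective.of_comp
      (f := fun i => (Pi.single i 1 : Fin m → K)) hinj)
  · have h := (ιMulti K m).map_perm (fun j => (Pi.single j 1 : Fin m → K)) σ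
    rw [Matrix.of_apply]
    change _ = _ • (ιMulti K m) ((fun j => (Pi.single j 1 : Fin m → K)) ∘ σ)
    rw [h, Matrix.smul_apply, smul_comm, Units.smul_def, ← Int.cast_smul_eq_zsmul K,
      ← Int.cast_smul_eq_zsmul K, smul_eq_mul, mul_smul, smul_comm]

end AmitsurLevitzki

open AmitsurLevitzki in
/-- The **Amitsur–Levitzki theorem** in characteristic zero. -/
theorem isPolynomialIdentity_standardPolynomial_matrix {K : Type*} [Field K] [CharZero K]
    {ι : Type*} [Fintype ι] [DecidableEq ι] {n : ℕ} (hn : Fintype.card ι ≤ n) :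
    IsPolynomialIdentity (standardPolynomial (2 * n)) (Matrix ι ι K) := by
  intro A
  set B : Matrix ι ι (Fin (2 * n) → K) :=
    Matrix.of fun p q => ∑ i, A i p q • (Pi.single i 1 : Fin (2 * n) → K) with hB
  have hnil : IsNilpotent (B.map (ExteriorAlgebra.ι K)) := by
    -- A word of length 2n + 1 in 2n letters repeats a letter.
    refine ⟨2 * n + 1, ?_⟩
    rw [hB, map_ι_pow]
    refine Finset.sum_eq_zero fun f _ => ?_
    ext p q
    rw [Matrix.of_apply, ExteriorAlgebra.ιMulti_eq_zero_of_not_inj, smul_zero, Matrix.zero_apply]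
    intro hinj
    simpa using Fintype.card_le_of_injective f (Function.Injective.of_comp
      (f := fun i => (Pi.single i 1 : Fin (2 * n) → K)) hinj)
  have hzero : B.map (ExteriorAlgebra.ι K) ^ (2 * n) = 0 :=
    pow_eq_zero_of_le (Nat.mul_le_mul_left 2 hn) (pow_two_mul_card_eq_zero B hnil)
  rw [lift_standardPolynomial]
  ext p q
  have h := map_ι_pow_fin A p q
  rw [← hB, hzero, Matrix.zero_apply] at h
  exact (smul_eq_zero.1 h.symm).resolve_right (ιMulti_single_ne_zero _)

theorem isPolynomialIdentity_standardPolynomial_end {K V : Type*} [Field K] [CharZero K]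
    [AddCommGroup V] [Module K V] {n : ℕ} (hn : Module.rank K V ≤ n) :
    IsPolynomialIdentity (standardPolynomial (2 * n)) (Module.End K V) := by
  have : Module.Finite K V := Module.rank_lt_aleph0_iff.1 (hn.trans_lt (Cardinal.natCast_lt_aleph0))
  have e := algEquivMatrix (Module.finBasis K V)
  refine IsPolynomialIdentity.of_injective e.toRingEquiv.toRingHom e.injective
    (isPolynomialIdentity_standardPolynomial_matrix ?_)
  rw [Fintype.card_fin]
  exact Module.finrank_le_of_rank_le hn

/-! ### Boundedness and the Jacobson radical -/

namespace UnitaryRep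

variable {A : Type u} [Ring A] [StarRing A] [Algebra ℂ A]
  {V : Type v} [NormedAddCommGroup V] [InnerProductSpace ℂ V]

theorem inner_map_right (ρ : UnitaryRep A V) (a : A) (x y : V) :
    inner ℂ x (ρ.toHom a y) = inner ℂ (ρ.toHom (star a) x) y := by
  rw [ρ.inner_map_left, star_star]

/-- The orthogonal complement of an invariant subspace is invariant too, because a* also preserves
the subspace. -/
theorem starProjection_commute (ρ : UnitaryRep A V) (W : Submodule ℂ V)
    [W.HasOrthogonalProjection] (hW : ∀ (a : A), ∀ x ∈ W, ρ.toHom a x ∈ W) (a : A) (x : V) :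
    W.starProjection (ρ.toHom a x) = ρ.toHom a (W.starProjection x) := by
  refine Submodule.eq_starProjection_of_mem_of_inner_eq_zero
    (hW a _ (W.starProjection_apply_mem x)) fun w hw => ?_
  rw [← map_sub, ρ.inner_map_left]
  exact W.starProjection_inner_eq_zero x _ (hW _ w hw)

/-- The direct sum of finitely many copies of a unitary representation. -/
noncomputable def diagonal (ρ : UnitaryRep A V) (ι : Type*) [Fintype ι] :
    UnitaryRep A (PiLp 2 fun _ : ι => V) where
  toHom :=
    { toFun := fun a =>
        { toFun := fun x => WithLp.toLp 2 fun i => ρ.toHom a (x i)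
          map_add' := fun x y => by ext i; simp
          map_smul' := fun c x => by ext i; simp }
      map_one' := by ext; simp
      map_mul' := fun a b => by ext; simp
      map_zero' := by ext; simp
      map_add' := fun a b => by ext; simp
      commutes' := fun r => by ext; simp [Algebra.algebraMap_eq_smul_one] }
  inner_map_left a x y := by simp [PiLp.inner_apply, ρ.inner_map_left]

@[simp]
theorem diagonal_apply (ρ : UnitaryRep A V) {ι : Type*} [Fintype ι] (a : A)
    (x : PiLp 2 fun _ : ι => V) (i : ι) : (ρ.diagonal ι).toHom a x i = ρ.toHom a (x i) := rfl

section Complete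

variable [CompleteSpace V] (ρ : UnitaryRep A V)

/-- The operators of a unitary representation on a Hilbert space are bounded, by the closed graph
theorem. -/
theorem continuous_toHom (a : A) : Continuous (ρ.toHom a) := by
  refine (ρ.toHom a).continuous_of_seq_closed_graph fun u x y hu hTu => ?_
  refine ext_inner_right ℂ fun z => ?_
  rw [ρ.inner_map_left]
  refine tendsto_nhds_unique (hTu.inner tendsto_const_nhds) ?_
  simp only [Function.comp_def, ρ.inner_map_left]
  exact hu.inner tendsto_const_nhds

/-- The `*`-homomorphism to bounded operators given by a unitary representation on a Hilbert
space. -/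
noncomputable def toStarAlgHom : A →⋆ₐ[ℂ] (V →L[ℂ] V) where
  toFun a := ⟨ρ.toHom a, ρ.continuous_toHom a⟩
  map_one' := by ext; simp
  map_mul' a b := by ext; simp
  map_zero' := by ext; simp
  map_add' a b := by ext; simp
  commutes' r := by ext; simp [Algebra.algebraMap_eq_smul_one]
  map_star' a := by
    rw [ContinuousLinearMap.star_eq_adjoint, ContinuousLinearMap.eq_adjoint_iff]
    exact fun x y => (ρ.inner_map_right a x y).symm

@[simp]
theorem toStarAlgHom_apply (a : A) (x : V) : ρ.toStarAlgHom a x = ρ.toHom a x := rfl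

end Complete

end UnitaryRep

/-- For k ≠ 0 the element k - x*x is already invertible in `A`, so the image of x*x has spectrum
{0}. For a self-adjoint element the spectral radius is the norm, and the C*-identity concludes. No
topology on `A` is needed. -/
theorem StarAlgHom.map_eq_zero_of_mem_jacobson {A B : Type*} [Ring A] [StarRing A] [Algebra ℂ A]
    [CStarAlgebra B] (φ : A →⋆ₐ[ℂ] B) {x : A} (hx : x ∈ Ring.jacobson A) : φ x = 0 := by
  nontriviality B
  have hspec : ∀ k ∈ spectrum ℂ (star (φ x) * φ x), k = 0 := by
    intro k hk
    by_contra hk0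
    refine hk ?_
    have hmem : -(k⁻¹ • (star x * x)) ∈ Ring.jacobson A := by
      rw [Algebra.smul_def]
      exact neg_mem (Ideal.mul_mem_left _ _ (Ideal.mul_mem_left _ _ hx))
    have hu := ((Ring.isUnit_one_add_of_mem_jacobson hmem).map φ).smul (Units.mk0 k hk0)
    rw [spectrum.mem_resolventSet_iff]
    convert hu using 1
    simp [Units.smul_def, Algebra.algebraMap_eq_smul_one, smul_smul, hk0, sub_eq_add_neg,
      map_star]
  have hr : spectralRadius ℂ (star (φ x) * φ x) = 0 := by
    rw [spectralRadius, ENNReal.iSup_eq_zero]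
    intro k
    rw [ENNReal.iSup_eq_zero]
    intro hk
    simp [hspec k hk]
  rw [(IsSelfAdjoint.star_mul_self (φ x)).spectralRadius_eq_nnnorm] at hr
  have : star (φ x) * φ x = 0 := by simpa using hr
  exact CStarRing.star_mul_self_eq_zero_iff _ |>.1 this

namespace UnitaryRep

variable {A : Type u} [Ring A] [StarRing A] [Algebra ℂ A]
  {V : Type v} [NormedAddCommGroup V] [InnerProductSpace ℂ V] [CompleteSpace V]

theorem toStarAlgHom_eq_zero_of_mem_jacobson (ρ : UnitaryRep A V) {x : A}
    (hx : x ∈ Ring.jacobson A) : ρ.toStarAlgHom x = 0 :=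
  ρ.toStarAlgHom.map_eq_zero_of_mem_jacobson hx

/-! ### The commutant of an irreducible representation -/

/-- Two distinct spectral values would give nonzero f(T), g(T) with f(T) g(T) = 0. The kernel of
f(T) is then closed, invariant, proper, and nonzero since it contains the range of g(T). -/
theorem IsIrreducible.eq_smul_one_of_isSelfAdjoint {ρ : UnitaryRep A V} (hρ : ρ.IsIrreducible)
    {T : V →L[ℂ] V} (hT : IsSelfAdjoint T) (hcomm : ∀ a, Commute T (ρ.toStarAlgHom a)) :
    ∃ c : ℂ, T = c • 1 := by
  have := hρ.nontrivial
  have hne : (spectrum ℝ T).Nonempty := ContinuousFunctionalCalculus.spectrum_nonempty T hT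
  obtain ⟨x, hx⟩ := hne
  by_cases hall : ∀ y ∈ spectrum ℝ T, y = x
  · refine ⟨x, ?_⟩
    calc T = cfc (fun y : ℝ => y) T := (cfc_id' ℝ T).symm
      _ = cfc (fun _ : ℝ => x) T := cfc_congr fun y hy => hall y hy
      _ = algebraMap ℝ _ x := cfc_const x T
      _ = _ := by rw [Algebra.algebraMap_eq_smul_one]; rfl
  · exfalso
    push Not at hall
    obtain ⟨y, hy, hyx⟩ := hall
    obtain ⟨s, t, hs, ht, hst⟩ : ∃ s t, s ∈ spectrum ℝ T ∧ t ∈ spectrum ℝ T ∧ s < t := by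
      rcases lt_or_gt_of_ne hyx with h | h
      exacts [⟨y, x, hy, hx, h⟩, ⟨x, y, hx, hy, h⟩]
    set m := (s + t) / 2
    set f : ℝ → ℝ := fun r => max (m - r) 0
    set g : ℝ → ℝ := fun r => max (r - m) 0
    have hf : Continuous f := by fun_prop
    have hg : Continuous g := by fun_prop
    have hfg : cfc f T * cfc g T = 0 := by
      rw [← cfc_mul f g T hf.continuousOn hg.continuousOn]
      have : (fun r => f r * g r) = fun _ => 0 := by
        ext r
        rcases le_total r m with h | h
        · simp [g, max_eq_right (sub_nonpos.2 h)]
        · simp [f, max_eq_right (sub_nonpos.2 h)]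
      rw [this, cfc_const_zero]
    have hne : ∀ h : ℝ → ℝ, Continuous h → ∀ r ∈ spectrum ℝ T, h r ≠ 0 → cfc h T ≠ 0 := by
      intro h hc r hr hr0 h0
      have hmem : h r ∈ spectrum ℝ (cfc h T) := by
        rw [cfc_map_spectrum h T hT hc.continuousOn]
        exact ⟨r, hr, rfl⟩
      rw [h0, spectrum.zero_eq] at hmem
      exact hr0 hmem
    have hf0 : cfc f T ≠ 0 := hne f hf s hs (by simp only [f, m]; rw [max_eq_left] <;> linarith)
    have hg0 : cfc g T ≠ 0 := hne g hg t ht (by simp only [g, m]; rw [max_eq_left] <;> linarith)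
    have hfc : ∀ a, Commute (cfc f T) (ρ.toStarAlgHom a) := fun a =>
      (hcomm a).cfc_real f
    rcases hρ.eq_bot_or_eq_top (cfc f T).ker (ContinuousLinearMap.isClosed_ker _) fun a z hz => by
        rw [LinearMap.mem_ker] at hz ⊢
        have := DFunLike.congr_fun (hfc a).eq z
        simp only [mul_apply_eq_comp, toStarAlgHom_apply] at this
        change (cfc f T) (ρ.toHom a z) = 0
        rw [this]
        exact (congrArg (ρ.toHom a) hz).trans (map_zero _) with h | h
    · refine hg0 (ContinuousLinearMap.ext fun z => ?_)
      have hz : cfc g T z ∈ (cfc f T).ker := DFunLike.congr_fun hfg z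
      rw [h] at hz
      exact hz
    · refine hf0 (ContinuousLinearMap.ext fun z => ?_)
      have hz : z ∈ (cfc f T).ker := h ▸ Submodule.mem_top
      exact hz

/-- Schur's lemma for topologically irreducible representations. -/
theorem IsIrreducible.eq_smul_one_of_commute {ρ : UnitaryRep A V} (hρ : ρ.IsIrreducible)
    {T : V →L[ℂ] V} (hcomm : ∀ a, Commute T (ρ.toStarAlgHom a)) : ∃ c : ℂ, T = c • 1 := by
  have hstar : ∀ a, Commute (star T) (ρ.toStarAlgHom a) := fun a => by
    have := (hcomm (star a)).star_star
    rwa [← map_star, star_star] at this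
  obtain ⟨c, hc⟩ := hρ.eq_smul_one_of_isSelfAdjoint (realPart T).2 fun a => by
    rw [realPart_apply_coe]
    exact ((hcomm a).add_left (hstar a)).smul_left _
  obtain ⟨d, hd⟩ := hρ.eq_smul_one_of_isSelfAdjoint (imaginaryPart T).2 fun a => by
    rw [imaginaryPart_apply_coe]
    exact (((hcomm a).sub_left (hstar a)).smul_left _).smul_left _
  refine ⟨c + Complex.I * d, ?_⟩
  rw [← realPart_add_I_smul_imaginaryPart T, hc, hd, smul_smul, add_smul]

/-! ### Density of an irreducible representation -/

/-- The image of an irreducible representation is strongly dense in the bounded operators. -/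
theorem IsIrreducible.exists_norm_sub_lt {ρ : UnitaryRep A V} (hρ : ρ.IsIrreducible)
    {ι : Type*} [Fintype ι] (u : ι → V) (T : V →L[ℂ] V) {ε : ℝ} (hε : 0 < ε) :
    ∃ a : A, ∀ i, ‖ρ.toHom a (u i) - T (u i)‖ < ε := by
  classical
  let D := ρ.diagonal ι
  let U : PiLp 2 fun _ : ι => V := WithLp.toLp 2 u
  let orbit : A →ₗ[ℂ] PiLp 2 fun _ : ι => V := (LinearMap.applyₗ U) ∘ₗ D.toHom.toLinearMap
  let W : Submodule ℂ (PiLp 2 fun _ : ι => V) := (LinearMap.range orbit).topologicalClosure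
  have : CompleteSpace W := (Submodule.isClosed_topologicalClosure _).completeSpace_coe
  have hW : ∀ (a : A), ∀ x ∈ W, D.toHom a x ∈ W := by
    intro a x hx
    refine map_mem_closure (D.continuous_toHom a) hx ?_
    rintro _ ⟨b, rfl⟩
    exact ⟨a * b, by simp [orbit]⟩
  have hP := D.starProjection_commute W hW
  let single (j : ι) : V →L[ℂ] PiLp 2 fun _ : ι => V :=
    (PiLp.continuousLinearEquiv 2 ℂ fun _ : ι => V).symm.toContinuousLinearMap ∘L
      ContinuousLinearMap.single ℂ (fun _ : ι => V) j
  have hsingle : ∀ a j x, single j (ρ.toHom a x) = D.toHom a (single j x) := by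
    intro a j x
    ext i
    by_cases h : i = j
    · subst h; simp [single, D]
    · simp [single, D, h]
  -- The projection onto the closed orbit commutes with the diagonal action, so its matrix entries
  -- lie in the commutant and are scalars by Schur's lemma.
  have hentry : ∀ i j, ∃ c : ℂ,
      (PiLp.proj 2 (fun _ : ι => V) i) ∘L W.starProjection ∘L single j = c • 1 := by
    intro i j
    refine hρ.eq_smul_one_of_commute fun a => ContinuousLinearMap.ext fun x => ?_
    simp [hsingle, hP, D]
  choose c hc using hentry
  have hPx : ∀ x i, W.starProjection x i = ∑ j, c i j • x j := by
    intro x i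
    have hx : x = ∑ j, single j (x j) := by
      ext k
      simp [single, Pi.single_apply]
    conv_lhs => rw [hx, map_sum]
    have : ∀ j, W.starProjection (single j (x j)) i = c i j • x j := fun j =>
      DFunLike.congr_fun (hc i j) (x j)
    simp [this]
  have hU : U ∈ W := subset_closure ⟨1, by simp [orbit]⟩
  -- A matrix of scalars commutes with T applied in each coordinate, so T maps the fixed vector `U`
  -- of the projection to another fixed vector.
  have hTU : (WithLp.toLp 2 fun i => T (u i) : PiLp 2 fun _ : ι => V) ∈ W := by
    rw [← Submodule.starProjection_eq_self_iff]
    ext i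
    have := hPx U i
    rw [Submodule.starProjection_eq_self_iff.2 hU] at this
    rw [hPx]
    simpa using (congrArg T this).symm
  obtain ⟨_, ⟨a, rfl⟩, ha⟩ := Metric.mem_closure_iff.1 hTU ε hε
  refine ⟨a, fun i => lt_of_le_of_lt ?_ ha⟩
  rw [dist_comm, dist_eq_norm]
  exact PiLp.norm_apply_le (orbit a - WithLp.toLp 2 fun i => T (u i)) i

end UnitaryRep

/-! ### Identities of an irreducible representation -/

theorem List.exists_prod_map_update_eq {α R : Type*} [DecidableEq α] [Monoid R] (x : α → R)
    {i : α} {l : List α} (hl : l.Nodup) (hi : i ∈ l) :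
    ∃ p q : R, ∀ y, (l.map (Function.update x i y)).prod = p * y * q := by
  obtain ⟨s, t, rfl⟩ := List.append_of_mem hi
  have hs : i ∉ s := fun h => (List.nodup_append.1 hl).2.2 i h i (by simp) rfl
  have ht : i ∉ t := (List.nodup_cons.1 (List.nodup_append.1 hl).2.1).1
  have hmap : ∀ {r : List α}, i ∉ r → ∀ y, r.map (Function.update x i y) = r.map x :=
    fun hr y => List.map_congr_left fun j hj =>
      Function.update_of_ne (ne_of_mem_of_not_mem hj hr) _ _
  refine ⟨(s.map x).prod, (t.map x).prod, fun y => ?_⟩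
  simp [hmap hs, hmap ht, mul_assoc]

/-- Each monomial contains the i-th variable exactly once. In this form, varying that variable alone
is strongly continuous. -/
theorem exists_lift_standardPolynomial_update_eq {R : Type*} [Ring R] {m : ℕ} (x : Fin m → R)
    (i : Fin m) : ∃ p q : Equiv.Perm (Fin m) → R, ∀ y,
      FreeAlgebra.lift ℤ (Function.update x i y) (standardPolynomial m) =
        ∑ σ, p σ * y * q σ := by
  have h : ∀ σ : Equiv.Perm (Fin m), ∃ p q : R, ∀ y,
      (List.ofFn fun j => Function.update x i y (σ j)).prod = p * y * q := by
    intro σ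
    obtain ⟨p, q, h⟩ := List.exists_prod_map_update_eq x (i := i) (l := List.ofFn σ)
      (List.nodup_ofFn_ofInjective σ.injective) (by simpa [List.mem_ofFn] using σ.surjective i)
    exact ⟨p, q, fun y => by rw [← h, List.map_ofFn]; rfl⟩
  choose p q h using h
  refine ⟨fun σ => ((Equiv.Perm.sign σ : ℤˣ) : ℤ) • p σ, q, fun y => ?_⟩
  simp only [lift_standardPolynomial, h, smul_mul_assoc]

namespace UnitaryRep

variable {A : Type u} [Ring A] [StarRing A] [Algebra ℂ A]
  {V : Type v} [NormedAddCommGroup V] [InnerProductSpace ℂ V] [CompleteSpace V]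

/-- Multiplication is not jointly strongly continuous, so the variables are freed one at a time: `s`
holds those allowed outside the image of `A`, and one of them is approximated at the finitely many
vectors `q σ v`. -/
theorem IsIrreducible.isPolynomialIdentity_clm {ρ : UnitaryRep A V} (hρ : ρ.IsIrreducible) {m : ℕ}
    (h : ∀ x : Fin m → A,
      FreeAlgebra.lift ℤ (fun i => ρ.toStarAlgHom (x i)) (standardPolynomial m) = 0) :
    IsPolynomialIdentity (standardPolynomial m) (V →L[ℂ] V) := by
  suffices H : ∀ (s : Finset (Fin m)) (x : Fin m → V →L[ℂ] V),
      (∀ i ∉ s, ∃ a, ρ.toStarAlgHom a = x i) →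
      FreeAlgebra.lift ℤ x (standardPolynomial m) = 0 from
    fun x => H Finset.univ x fun i hi => absurd (Finset.mem_univ i) hi
  intro s
  induction s using Finset.induction_on with
  | empty =>
    intro x hx
    choose a ha using fun i => hx i (Finset.notMem_empty i)
    rw [← funext ha]
    exact h a
  | insert i s _ ih =>
    intro x hx
    obtain ⟨p, q, hpq⟩ := exists_lift_standardPolynomial_update_eq x i
    ext v
    have hbound : ∀ ε > 0, ‖FreeAlgebra.lift ℤ x (standardPolynomial m) v‖ ≤
        (∑ σ, ‖p σ‖) * ε := by
      intro ε hε
      obtain ⟨a, ha⟩ := hρ.exists_norm_sub_lt (fun σ => q σ v) (x i) hε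
      have h0 : FreeAlgebra.lift ℤ (Function.update x i (ρ.toStarAlgHom a))
          (standardPolynomial m) = 0 := by
        refine ih _ fun j hj => ?_
        by_cases hji : j = i
        · subst hji
          exact ⟨a, by simp⟩
        · rw [Function.update_of_ne hji]
          exact hx j (by simp [hji, hj])
      have h1 : FreeAlgebra.lift ℤ x (standardPolynomial m) v =
          -∑ σ, p σ (ρ.toHom a (q σ v) - x i (q σ v)) := by
        have hx1 := hpq (x i)
        rw [Function.update_eq_self] at hx1
        have hx0 := DFunLike.congr_fun (h0.symm.trans (hpq (ρ.toStarAlgHom a))) v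
        simp only [zero_apply, sum_apply,
          mul_apply_eq_comp, toStarAlgHom_apply] at hx0
        simp only [map_sub, Finset.sum_sub_distrib, ← hx0, hx1, sum_apply,
          mul_apply_eq_comp, zero_sub, neg_neg]
      rw [h1, norm_neg, Finset.sum_mul]
      refine (norm_sum_le _ _).trans (Finset.sum_le_sum fun σ _ => ?_)
      exact ((p σ).le_opNorm _).trans (mul_le_mul_of_nonneg_left (ha σ).le (norm_nonneg _))
    refine norm_le_zero_iff.1 (le_of_forall_pos_le_add fun δ hδ => ?_)
    -- The summand 1 keeps the divisor positive when every `p σ` is zero.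
    have hC : 0 < ∑ σ, ‖p σ‖ + 1 := by positivity
    refine (hbound (δ / (∑ σ, ‖p σ‖ + 1)) (by positivity)).trans ?_
    rw [zero_add, mul_div_assoc', div_le_iff₀ hC, mul_comm]
    gcongr
    linarith

end UnitaryRep

/-! ### The standard polynomial is not an identity in large dimension -/

section Staircase

open InnerProductSpace

variable {V : Type*} [NormedAddCommGroup V] [InnerProductSpace ℂ V]

/-- The staircase `e₀₀, e₀₁, e₁₁, e₁₂, …` of matrix units along a sequence of vectors. -/
noncomputable def staircase (e : ℕ → V) (k : ℕ) : V →L[ℂ] V :=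
  rankOne ℂ (e (k / 2)) (e ((k + 1) / 2))

/-- Adjacent factors a, b survive only if (a + 1)/2 = b/2 in integer division, which forces a ≤ b.
-/
theorem isChain_of_prod_staircase_ne_zero {e : ℕ → V} (he : ∀ i j, i ≠ j → inner ℂ (e i) (e j) = 0)
    (l : List ℕ) (hl : (l.map (staircase e)).prod ≠ 0) : l.IsChain (· ≤ ·) := by
  induction l with
  | nil => exact List.IsChain.nil
  | cons a l ih =>
    rw [List.map_cons, List.prod_cons] at hl
    have ih := ih (right_ne_zero_of_mul hl)
    cases l with
    | nil => exact List.IsChain.singleton _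
    | cons b l =>
      refine ih.cons_cons ?_
      rw [List.map_cons, List.prod_cons, ← mul_assoc] at hl
      have hab : (a + 1) / 2 = b / 2 := by
        by_contra hne
        refine left_ne_zero_of_mul hl ?_
        rw [ContinuousLinearMap.mul_def, staircase, staircase, rankOne_comp_rankOne, he _ _ hne,
          zero_smul]
      omega

theorem prod_staircase_apply {e : ℕ → V} {n : ℕ} (he : ∀ i ≤ n, inner ℂ (e i) (e i) = (1 : ℂ)) :
    ∀ m ≤ 2 * n, (List.ofFn fun k : Fin m => staircase e k).prod (e (m / 2)) = e 0 := by
  intro m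
  induction m with
  | zero => simp
  | succ m ih =>
    intro hm
    rw [List.ofFn_succ', List.concat_eq_append, List.prod_append, List.prod_singleton]
    simp only [mul_apply_eq_comp, Fin.val_last, Fin.val_castSucc]
    rw [staircase, rankOne_apply, he _ (by omega), one_smul]
    exact ih (by omega)

/-- A surviving permutation is monotone, hence the identity, and that single product telescopes from
the last vector to the first. -/
theorem lift_staircase_apply {e : ℕ → V} {n : ℕ} (he : ∀ i ≤ n, inner ℂ (e i) (e i) = (1 : ℂ))
    (he' : ∀ i j, i ≠ j → inner ℂ (e i) (e j) = 0) :
    FreeAlgebra.lift ℤ (fun k : Fin (2 * n) => staircase e k) (standardPolynomial (2 * n)) (e n) =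
      e 0 := by
  rw [lift_standardPolynomial, Finset.sum_eq_single 1]
  · have := prod_staircase_apply he (2 * n) le_rfl
    rw [Nat.mul_div_cancel_left n two_pos] at this
    simpa using this
  · intro σ _ hσ
    by_contra h0
    have hchain := isChain_of_prod_staircase_ne_zero he' (List.ofFn fun i => (σ i : ℕ)) (by
      rw [List.map_ofFn]
      exact right_ne_zero_of_smul h0)
    have hmono : Monotone σ := by
      rw [List.isChain_iff_pairwise, List.pairwise_ofFn] at hchain
      intro i j hij
      rcases hij.eq_or_lt with rfl | hlt
      exacts [le_rfl, hchain hlt]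
    refine hσ (DFunLike.coe_injective ?_)
    exact (StrictMono.range_inj (hmono.strictMono_of_injective σ.injective) strictMono_id).1
      (by simp [σ.surjective.range_eq])
  · simp

theorem rank_le_of_isPolynomialIdentity_clm {n : ℕ}
    (h : IsPolynomialIdentity (standardPolynomial (2 * n)) (V →L[ℂ] V)) :
    Module.rank ℂ V ≤ n := by
  by_contra hrank
  rw [not_le] at hrank
  have hrank : ((n + 1 : ℕ) : Cardinal) ≤ Module.rank ℂ V := by
    rw [Nat.cast_succ, ← Cardinal.succ_natCast]
    exact Order.succ_le_of_lt hrank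
  obtain ⟨f, hf⟩ := Module.le_rank_iff.1 hrank
  have horth := gramSchmidtNormed_orthonormal (𝕜 := ℂ) hf
  -- Padding by zero keeps orthogonality for all indices; unit length is needed only up to n.
  let e : ℕ → V := fun i => if hi : i < n + 1 then gramSchmidtNormed ℂ f ⟨i, hi⟩ else 0
  have he : ∀ i ≤ n, inner ℂ (e i) (e i) = (1 : ℂ) := by
    intro i hi
    simp only [e, dif_pos (Nat.lt_succ_of_le hi)]
    rw [inner_self_eq_norm_sq_to_K, horth.1]
    simp
  have he' : ∀ i j, i ≠ j → inner ℂ (e i) (e j) = (0 : ℂ) := by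
    intro i j hij
    by_cases hi : i < n + 1
    · by_cases hj : j < n + 1
      · simp only [e, dif_pos hi, dif_pos hj]
        exact horth.2 (by simpa using hij)
      · simp only [e, dif_neg hj, inner_zero_right]
    · simp only [e, dif_neg hi, inner_zero_left]
  have h0 := lift_staircase_apply he he'
  rw [h] at h0
  have := he 0 (Nat.zero_le n)
  rw [← h0] at this
  simp at this

end Staircase

theorem UnitaryRep.IsIrreducible.rank_le {A : Type u} [Ring A] [StarRing A] [Algebra ℂ A]
    {V : Type v} [NormedAddCommGroup V] [InnerProductSpace ℂ V] [CompleteSpace V]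
    {ρ : UnitaryRep A V} (hρ : ρ.IsIrreducible) {n : ℕ}
    (h : IsPolynomialIdentity (standardPolynomial (2 * n)) (A ⧸ Ring.jacobson A)) :
    Module.rank ℂ V ≤ n := by
  refine rank_le_of_isPolynomialIdentity_clm (hρ.isPolynomialIdentity_clm fun x => ?_)
  have h1 := h fun i => Ideal.Quotient.mk _ (x i)
  rw [← map_lift_standardPolynomial, Ideal.Quotient.eq_zero_iff_mem] at h1
  have h2 := ρ.toStarAlgHom_eq_zero_of_mem_jacobson h1
  exact (map_lift_standardPolynomial (ρ.toStarAlgHom : A →+* (V →L[ℂ] V)) x).symm.trans h2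

/-! ### States bounded by a seminorm -/

section BoundedState

variable {A : Type u} [Ring A] [StarRing A] [Algebra ℂ A]

/-- States on a `*`-algebra that are dominated by a function `p`, in such a way that the associated
GNS operators have norm at most `p`. -/
structure IsBoundedState (p : A → ℝ) (f : A → ℂ) : Prop where
  map_add : ∀ a b, f (a + b) = f a + f b
  map_smul : ∀ (c : ℂ) a, f (c • a) = c * f a
  map_one : f 1 = 1
  map_star : ∀ a, f (star a) = (starRingEnd ℂ) (f a)
  nonneg : ∀ a, 0 ≤ (f (star a * a)).re
  norm_le : ∀ a, ‖f a‖ ≤ p a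
  re_mul_le : ∀ a b, (f (star (a * b) * (a * b))).re ≤ p a ^ 2 * (f (star b * b)).re

theorem isClosed_setOf_isBoundedState (p : A → ℝ) : IsClosed {f | IsBoundedState p f} := by
  have : {f | IsBoundedState p f} = {f | (∀ a b, f (a + b) = f a + f b) ∧
      (∀ (c : ℂ) a, f (c • a) = c * f a) ∧ f 1 = 1 ∧
      (∀ a, f (star a) = (starRingEnd ℂ) (f a)) ∧ (∀ a, 0 ≤ (f (star a * a)).re) ∧
      (∀ a, ‖f a‖ ≤ p a) ∧
      ∀ a b, (f (star (a * b) * (a * b))).re ≤ p a ^ 2 * (f (star b * b)).re} := by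
    ext f
    exact ⟨fun h => ⟨h.1, h.2, h.3, h.4, h.5, h.6, h.7⟩,
      fun ⟨h1, h2, h3, h4, h5, h6, h7⟩ => ⟨h1, h2, h3, h4, h5, h6, h7⟩⟩
  rw [this]
  simp only [Set.ofPred_and, Set.ofPred_forall]
  have hre : ∀ a : A, Continuous fun f : A → ℂ => (f a).re := fun a =>
    Complex.continuous_re.comp (continuous_apply a)
  have hconj : ∀ a : A, Continuous fun f : A → ℂ => (starRingEnd ℂ) (f a) := fun a =>
    Complex.continuous_conj.comp (continuous_apply a)
  refine IsClosed.inter ?_ <| IsClosed.inter ?_ <| IsClosed.inter ?_ <| IsClosed.inter ?_ <|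
    IsClosed.inter ?_ <| IsClosed.inter ?_ ?_
  · exact isClosed_iInter fun a => isClosed_iInter fun b => isClosed_eq (by fun_prop) (by fun_prop)
  · exact isClosed_iInter fun a => isClosed_iInter fun b => isClosed_eq (by fun_prop) (by fun_prop)
  · exact isClosed_eq (by fun_prop) (by fun_prop)
  · exact isClosed_iInter fun a => isClosed_eq (by fun_prop) (hconj a)
  · exact isClosed_iInter fun a => isClosed_le (by fun_prop) (hre _)
  · exact isClosed_iInter fun a => isClosed_le (by fun_prop) (by fun_prop)
  · exact isClosed_iInter fun a => isClosed_iInter fun b =>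
      isClosed_le (hre _) (continuous_const.mul (hre _))

theorem isCompact_setOf_isBoundedState (p : A → ℝ) : IsCompact {f | IsBoundedState p f} := by
  refine (isCompact_univ_pi fun a : A => isCompact_closedBall (0 : ℂ) (p a)).of_isClosed_subset
    (isClosed_setOf_isBoundedState p) fun f hf a _ => ?_
  rw [mem_closedBall_zero_iff]
  exact hf.norm_le a

/-- Some extreme bounded state attains the maximum of `f ↦ f (s* s)`. -/
theorem exists_extreme_isBoundedState {p : A → ℝ} {f₀ : A → ℂ} (h₀ : IsBoundedState p f₀) (s : A) :
    ∃ f ∈ Set.extremePoints ℝ {f | IsBoundedState p f},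
      (f₀ (star s * s)).re ≤ (f (star s * s)).re := by
  let l : (A → ℂ) →L[ℝ] ℝ := Complex.reCLM ∘L ContinuousLinearMap.proj (R := ℝ) (star s * s)
  -- The maximisers form a compact exposed face, which has an extreme point by Krein–Milman; extreme
  -- points of a face are extreme in the whole set.
  have hexp := ContinuousLinearMap.toExposed.isExposed (l := l) (A := {f | IsBoundedState p f})
  have hK := isCompact_setOf_isBoundedState p
  have hne : (l.toExposed {f | IsBoundedState p f}).Nonempty := by
    obtain ⟨f, hf, hmax⟩ := hK.exists_isMaxOn ⟨f₀, h₀⟩ l.continuous.continuousOn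
    exact ⟨f, hf, hmax⟩
  obtain ⟨f, hf⟩ := (hexp.isCompact hK).extremePoints_nonempty hne
  exact ⟨f, hexp.isExtreme.extremePoints_subset_extremePoints hf, hf.1.2 f₀ h₀⟩

end BoundedState

/-! ### Vector states -/

namespace UnitaryRep

section VectorState

variable {A : Type u} [Ring A] [StarRing A] [Algebra ℂ A]
  {V : Type v} [NormedAddCommGroup V] [InnerProductSpace ℂ V]

/-- The functional `a ↦ ⟪ξ, a ξ⟫`. -/
noncomputable def vectorState (ρ : UnitaryRep A V) (ξ : V) (a : A) : ℂ :=
  inner ℂ ξ (ρ.toHom a ξ)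

theorem vectorState_star_mul_self (ρ : UnitaryRep A V) (ξ : V) (a : A) :
    ρ.vectorState ξ (star a * a) = (‖ρ.toHom a ξ‖ : ℂ) ^ 2 := by
  rw [vectorState, map_mul, Module.End.mul_apply, ← ρ.inner_map_left]
  exact inner_self_eq_norm_sq_to_K _

theorem re_vectorState_star_mul_self (ρ : UnitaryRep A V) (ξ : V) (a : A) :
    (ρ.vectorState ξ (star a * a)).re = ‖ρ.toHom a ξ‖ ^ 2 := by
  rw [vectorState_star_mul_self]
  norm_cast

theorem isBoundedState_vectorState (ρ : UnitaryRep A V) {p : A → ℝ}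
    (hp : ∀ a v, ‖ρ.toHom a v‖ ≤ p a * ‖v‖) {ξ : V} (hξ : ‖ξ‖ = 1) :
    IsBoundedState p (ρ.vectorState ξ) where
  map_add a b := by simp [vectorState]
  map_smul c a := by simp [vectorState]
  map_one := by simp [vectorState, inner_self_eq_norm_sq_to_K, hξ]
  map_star a := by rw [vectorState, vectorState, inner_conj_symm, ρ.inner_map_left]
  nonneg a := by rw [re_vectorState_star_mul_self]; positivity
  norm_le a := by
    have h := (norm_inner_le_norm (𝕜 := ℂ) ξ (ρ.toHom a ξ)).trans
      (mul_le_mul_of_nonneg_left (hp a ξ) (norm_nonneg ξ))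
    rw [hξ, one_mul, mul_one] at h
    exact h
  re_mul_le a b := by
    rw [re_vectorState_star_mul_self, re_vectorState_star_mul_self, ← mul_pow, map_mul]
    exact pow_le_pow_left₀ (norm_nonneg _) (hp a _) 2

theorem vectorState_smul (ρ : UnitaryRep A V) (r : ℝ) (ξ : V) (a : A) :
    ρ.vectorState ((r : ℂ) • ξ) a = (r ^ 2 : ℝ) • ρ.vectorState ξ a := by
  simp only [vectorState, map_smul, inner_smul_left, inner_smul_right, Complex.conj_ofReal,
    Complex.real_smul, Complex.ofReal_pow]
  ring

/-- A cyclic representation whose cyclic vector gives an extreme state is irreducible. -/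
theorem isIrreducible_of_vectorState_mem_extremePoints [CompleteSpace V] {ρ : UnitaryRep A V}
    {p : A → ℝ} (hp : ∀ a v, ‖ρ.toHom a v‖ ≤ p a * ‖v‖) {ξ : V} (hξ : ‖ξ‖ = 1)
    (hcyc : DenseRange fun a => ρ.toHom a ξ)
    (hext : ρ.vectorState ξ ∈ Set.extremePoints ℝ {f | IsBoundedState p f}) :
    ρ.IsIrreducible where
  nontrivial := ⟨ξ, 0, fun h => by simp [h] at hξ⟩
  eq_bot_or_eq_top W hWc hW := by
    have : CompleteSpace W := hWc.completeSpace_coe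
    set P := W.starProjection with hPdef
    have hP := ρ.starProjection_commute W hW
    -- If both components of ξ along `W` and its complement are nonzero, the state is a proper
    -- convex combination of their normalised vector states.
    set η := P ξ with hη
    set ζ := ξ - η with hζ
    by_cases hη0 : η = 0
    · left
      have h0 : (P : V → V) = fun _ => 0 := hcyc.equalizer P.continuous continuous_const <| by
        ext a
        change P (ρ.toHom a ξ) = 0
        rw [hP, ← hPdef, ← hη, hη0, map_zero]
      refine (Submodule.eq_bot_iff W).2 fun x hx => ?_
      rw [← Submodule.starProjection_eq_self_iff.2 hx]
      exact congrFun h0 x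
    by_cases hζ0 : ζ = 0
    · right
      have h0 : (P : V → V) = id := hcyc.equalizer P.continuous continuous_id <| by
        ext a
        change P (ρ.toHom a ξ) = ρ.toHom a ξ
        rw [hP, ← hPdef, ← hη, ← sub_eq_zero.1 hζ0]
      refine Submodule.eq_top_iff'.2 fun x => ?_
      exact Submodule.starProjection_eq_self_iff.1 (congrFun h0 x)
    exfalso
    have hWη : ∀ a, ρ.toHom a η ∈ W := fun a => hW a _ (W.starProjection_apply_mem ξ)
    have hζW : ∀ w ∈ W, inner ℂ ζ w = (0 : ℂ) := fun w hw => W.starProjection_inner_eq_zero ξ w hw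
    have hζW' : ∀ w ∈ W, inner ℂ w ζ = (0 : ℂ) := fun w hw => inner_eq_zero_symm.1 (hζW w hw)
    have hηW : η ∈ W := W.starProjection_apply_mem ξ
    have hsum : ξ = η + ζ := by rw [hζ]; abel
    have hcross : ∀ a, inner ℂ η (ρ.toHom a ζ) = (0 : ℂ) := fun a => by
      rw [ρ.inner_map_right]; exact hζW' _ (hW _ _ hηW)
    have hsplit : ∀ a, ρ.vectorState ξ a = ρ.vectorState η a + ρ.vectorState ζ a := fun a => by
      rw [hsum]
      simp only [vectorState, map_add, inner_add_left, inner_add_right]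
      rw [hcross, hζW _ (hWη a)]
      ring
    have hnorm : ‖η‖ ^ 2 + ‖ζ‖ ^ 2 = 1 := by
      have := hsplit 1
      simp only [vectorState, map_one, Module.End.one_apply, inner_self_eq_norm_sq_to_K, hξ] at this
      have h2 : ((‖η‖ ^ 2 + ‖ζ‖ ^ 2 : ℝ) : ℂ) = 1 := by
        push_cast
        simpa using this.symm
      exact_mod_cast h2
    have hηn : ‖η‖ ≠ 0 := norm_ne_zero_iff.2 hη0
    have hζn : ‖ζ‖ ≠ 0 := norm_ne_zero_iff.2 hζ0
    have hunit : ∀ x : V, ‖x‖ ≠ 0 → ‖((‖x‖⁻¹ : ℝ) : ℂ) • x‖ = 1 := fun x hx => by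
      rw [norm_smul, Complex.norm_real, norm_inv, norm_norm, inv_mul_cancel₀ hx]
    have hscale : ∀ x : V, ‖x‖ ≠ 0 → ‖x‖ ^ 2 • ρ.vectorState (((‖x‖⁻¹ : ℝ) : ℂ) • x) =
        ρ.vectorState x := fun x hx => by
      ext a
      rw [Pi.smul_apply, vectorState_smul, smul_smul, ← mul_pow, mul_inv_cancel₀ hx, one_pow,
        one_smul]
    have heq := (mem_extremePoints.1 hext).2 _ (ρ.isBoundedState_vectorState hp (hunit η hηn)) _
      (ρ.isBoundedState_vectorState hp (hunit ζ hζn))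
      ⟨‖η‖ ^ 2, ‖ζ‖ ^ 2, by positivity, by positivity, hnorm, by
        rw [hscale η hηn, hscale ζ hζn]
        ext a
        exact (hsplit a).symm⟩
    have hstate : ρ.vectorState η = ‖η‖ ^ 2 • ρ.vectorState ξ := by
      rw [← heq.1, hscale η hηn]
    -- By extremality η and ‖η‖² ξ have equal inner products with the dense orbit of ξ, so they
    -- coincide. Applying the projection then forces ‖η‖ = 1 and ζ = 0.
    have hzero : η - ((‖η‖ ^ 2 : ℝ) : ℂ) • ξ = 0 := by
      have hfun : (fun x : V => inner ℂ (η - ((‖η‖ ^ 2 : ℝ) : ℂ) • ξ) x) = fun _ => (0 : ℂ) := by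
        refine hcyc.equalizer (by fun_prop) continuous_const ?_
        ext a
        have h1 : inner ℂ η (ρ.toHom a ξ) = ρ.vectorState η a := by
          rw [hsum, map_add, inner_add_right, hcross, add_zero]
          rfl
        change inner ℂ (η - ((‖η‖ ^ 2 : ℝ) : ℂ) • ξ) (ρ.toHom a ξ) = 0
        rw [inner_sub_left, h1, hstate, inner_smul_left, Complex.conj_ofReal]
        simp [vectorState]
      exact inner_self_eq_zero.1 (congrFun hfun _)
    have hη1 : η = ((‖η‖ ^ 2 : ℝ) : ℂ) • ξ := sub_eq_zero.1 hzero
    have hη2 : η = ((‖η‖ ^ 2 : ℝ) : ℂ) • η := by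
      have := congrArg P hη1
      rwa [map_smul, ← hη, Submodule.starProjection_eq_self_iff.2 hηW] at this
    have h3 : ((1 : ℂ) - ((‖η‖ ^ 2 : ℝ) : ℂ)) • η = 0 := by
      rw [sub_smul, one_smul, ← hη2, sub_self]
    have h4 : (‖η‖ ^ 2 : ℝ) = 1 := by
      have := sub_eq_zero.1 ((smul_eq_zero.1 h3).resolve_right hη0)
      exact_mod_cast this.symm
    rw [h4] at hnorm
    exact hζn (by simpa using hnorm)

end VectorState

/-! ### The Gelfand–Naimark–Segal construction -/

section GNS

variable {A : Type u} [Ring A] [StarRing A] [Algebra ℂ A]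

set_option linter.unusedVariables false in
/-- The algebra itself, with the inner product `⟪a, b⟫ = f (a* b)`. -/
def PreGNS {p : A → ℝ} {f : A → ℂ} (hf : IsBoundedState p f) : Type u := A

variable [StarModule ℂ A] {p : A → ℝ} {f : A → ℂ} (hf : IsBoundedState p f)

instance : AddCommGroup (PreGNS hf) := inferInstanceAs (AddCommGroup A)
instance : Module ℂ (PreGNS hf) := inferInstanceAs (Module ℂ A)

/-- The class of an element of the algebra in the space of the GNS construction. -/
def toPreGNS : A ≃ₗ[ℂ] PreGNS hf := LinearEquiv.refl ℂ _

/-- The pre-inner product `⟪a, b⟫ = f (a* b)`. -/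
noncomputable abbrev preGNSCore : PreInnerProductSpace.Core ℂ (PreGNS hf) where
  inner a b := f (star ((toPreGNS hf).symm a) * (toPreGNS hf).symm b)
  conj_inner_symm a b := by rw [← hf.map_star, star_mul, star_star]
  re_inner_nonneg a := hf.nonneg _
  add_left a b c := by rw [map_add, star_add, add_mul, hf.map_add]
  smul_left a b c := by rw [map_smul, star_smul, smul_mul_assoc, hf.map_smul]; rfl

noncomputable instance : SeminormedAddCommGroup (PreGNS hf) :=
  InnerProductSpace.Core.toSeminormedAddCommGroup (c := preGNSCore hf)
noncomputable instance : InnerProductSpace ℂ (PreGNS hf) :=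
  InnerProductSpace.ofCore (preGNSCore hf)

theorem inner_toPreGNS (a b : A) :
    inner ℂ (toPreGNS hf a) (toPreGNS hf b) = f (star a * b) := rfl

theorem norm_sq_toPreGNS (a : A) : ‖toPreGNS hf a‖ ^ 2 = (f (star a * a)).re := by
  rw [← inner_toPreGNS hf, ← inner_self_eq_norm_sq (𝕜 := ℂ)]
  rfl

/-- Left multiplication. -/
noncomputable def leftMul (a : A) : PreGNS hf →L[ℂ] PreGNS hf :=
  ((toPreGNS hf).toLinearMap ∘ₗ LinearMap.mulLeft ℂ a ∘ₗ
    (toPreGNS hf).symm.toLinearMap).mkContinuous (p a) fun x => by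
      obtain ⟨b, rfl⟩ := (toPreGNS hf).surjective x
      have hpa : 0 ≤ p a := (norm_nonneg _).trans (hf.norm_le a)
      refine le_of_sq_le_sq ?_ (by positivity)
      rw [mul_pow, norm_sq_toPreGNS]
      simpa [norm_sq_toPreGNS] using hf.re_mul_le a b

theorem norm_leftMul_apply_le (a : A) (x : PreGNS hf) : ‖leftMul hf a x‖ ≤ p a * ‖x‖ :=
  ContinuousLinearMap.le_of_opNorm_le _ (LinearMap.mkContinuous_norm_le _
    ((norm_nonneg _).trans (hf.norm_le a)) _) x

/-- The Hilbert space of the GNS construction. -/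
abbrev GNS := UniformSpace.Completion (PreGNS hf)

@[elab_as_elim]
theorem gns_induction {C : GNS hf → Prop} (x : GNS hf) (closed : IsClosed {x | C x})
    (coe : ∀ b : A, C (toPreGNS hf b)) : C x := by
  induction x using UniformSpace.Completion.induction_on with
  | hp => exact closed
  | ih x => exact coe ((toPreGNS hf).symm x)

theorem gns_clm_ext {S T : GNS hf →L[ℂ] GNS hf}
    (h : ∀ b, S (toPreGNS hf b) = T (toPreGNS hf b)) : S = T := by
  ext x
  induction x using gns_induction with
  | closed => exact isClosed_eq S.continuous T.continuous
  | coe b => exact h b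

/-- Left multiplication, as a bounded operator on the GNS space. -/
noncomputable def gnsOperator (a : A) : GNS hf →L[ℂ] GNS hf := (leftMul hf a).completion

theorem gnsOperator_coe (a b : A) :
    gnsOperator hf a (toPreGNS hf b) = (toPreGNS hf (a * b) : GNS hf) :=
  (leftMul hf a).completion_apply_coe (toPreGNS hf b)

theorem gnsOperator_one : gnsOperator hf 1 = 1 :=
  gns_clm_ext hf fun c => by rw [gnsOperator_coe, one_mul]; rfl

theorem gnsOperator_mul (a b : A) :
    gnsOperator hf (a * b) = gnsOperator hf a * gnsOperator hf b :=
  gns_clm_ext hf fun c => by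
    rw [mul_apply_eq_comp, gnsOperator_coe, gnsOperator_coe, gnsOperator_coe, mul_assoc]

theorem gnsOperator_add (a b : A) :
    gnsOperator hf (a + b) = gnsOperator hf a + gnsOperator hf b :=
  gns_clm_ext hf fun c => by
    rw [add_apply, gnsOperator_coe, gnsOperator_coe, gnsOperator_coe, add_mul, map_add,
      UniformSpace.Completion.coe_add]

theorem gnsOperator_smul (r : ℂ) (a : A) : gnsOperator hf (r • a) = r • gnsOperator hf a :=
  gns_clm_ext hf fun c => by
    rw [smul_apply, gnsOperator_coe, gnsOperator_coe, smul_mul_assoc, map_smul,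
      UniformSpace.Completion.coe_smul]

theorem inner_gnsOperator (a : A) (x y : GNS hf) :
    inner ℂ (gnsOperator hf a x) y = inner ℂ x (gnsOperator hf (star a) y) := by
  induction x using gns_induction with
  | closed => exact isClosed_eq (by fun_prop) (by fun_prop)
  | coe b =>
    induction y using gns_induction with
    | closed => exact isClosed_eq (by fun_prop) (by fun_prop)
    | coe c =>
      rw [gnsOperator_coe, gnsOperator_coe, UniformSpace.Completion.inner_coe,
        UniformSpace.Completion.inner_coe, inner_toPreGNS, inner_toPreGNS, star_mul, mul_assoc]

/-- The GNS representation of a bounded state. -/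
noncomputable def gns : UnitaryRep A (GNS hf) where
  toHom := AlgHom.ofLinearMap
    { toFun := fun a => (gnsOperator hf a).toLinearMap
      map_add' := fun a b => congrArg ContinuousLinearMap.toLinearMap (gnsOperator_add hf a b)
      map_smul' := fun r a => congrArg ContinuousLinearMap.toLinearMap (gnsOperator_smul hf r a) }
    (congrArg ContinuousLinearMap.toLinearMap (gnsOperator_one hf))
    (fun a b => congrArg ContinuousLinearMap.toLinearMap (gnsOperator_mul hf a b))
  inner_map_left := inner_gnsOperator hf

theorem gns_apply_coe (a b : A) :
    (gns hf).toHom a (toPreGNS hf b : GNS hf) =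
      (toPreGNS hf (a * b) : GNS hf) :=
  gnsOperator_coe hf a b

theorem norm_gns_apply_le (a : A) (x : GNS hf) :
    ‖(gns hf).toHom a x‖ ≤ p a * ‖x‖ := by
  have hcont : Continuous ((gns hf).toHom a) := (gns hf).continuous_toHom a
  induction x using gns_induction with
  | closed => exact isClosed_le (by fun_prop) (by fun_prop)
  | coe b =>
    rw [gns_apply_coe, UniformSpace.Completion.norm_coe, UniformSpace.Completion.norm_coe]
    exact norm_leftMul_apply_le hf a (toPreGNS hf b)

theorem norm_gns_one : ‖(toPreGNS hf 1 : GNS hf)‖ = 1 := by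
  rw [UniformSpace.Completion.norm_coe, ← sq_eq_sq₀ (norm_nonneg _) zero_le_one,
    norm_sq_toPreGNS]
  simp [hf.map_one]

theorem denseRange_gns_one : DenseRange fun a =>
    (gns hf).toHom a (toPreGNS hf 1 : GNS hf) := by
  simp only [gns_apply_coe, mul_one]
  exact UniformSpace.Completion.denseRange_coe.comp (toPreGNS hf).surjective.denseRange
    (UniformSpace.Completion.continuous_coe _)

theorem vectorState_gns_one :
    (gns hf).vectorState (toPreGNS hf 1 : GNS hf) = f := by
  ext a
  rw [vectorState, gns_apply_coe, UniformSpace.Completion.inner_coe, inner_toPreGNS, star_one,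
    one_mul, mul_one]

end GNS

/-- Irreducible unitary representations separate elements from zero, if some unitary representation
does. -/
theorem exists_isIrreducible_toHom_ne_zero {A : Type u} [Ring A] [StarRing A] [Algebra ℂ A]
    [StarModule ℂ A] {H : Type v} [NormedAddCommGroup H] [InnerProductSpace ℂ H] [CompleteSpace H]
    (π : UnitaryRep A H) {s : A} (hs : π.toHom s ≠ 0) :
    ∃ (V : Type u) (_ : NormedAddCommGroup V) (_ : InnerProductSpace ℂ V) (_ : CompleteSpace V)
      (ρ : UnitaryRep A V), ρ.IsIrreducible ∧ ρ.toHom s ≠ 0 := by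
  obtain ⟨x, hx⟩ : ∃ x, π.toHom s x ≠ 0 := by
    by_contra! h
    exact hs (LinearMap.ext h)
  have hx0 : ‖x‖ ≠ 0 := fun h => hx (by rw [norm_eq_zero.1 h, map_zero])
  set ξ : H := ((‖x‖⁻¹ : ℝ) : ℂ) • x
  have hξ : ‖ξ‖ = 1 := by
    rw [norm_smul, Complex.norm_real, norm_inv, norm_norm, inv_mul_cancel₀ hx0]
  have hsξ : π.toHom s ξ ≠ 0 := by
    rw [map_smul]
    exact smul_ne_zero (by exact_mod_cast inv_ne_zero hx0) hx
  -- The bound `p` is the operator norm in the given representation.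
  obtain ⟨f, hfext, hle⟩ := exists_extreme_isBoundedState
    (π.isBoundedState_vectorState (fun a v => (π.toStarAlgHom a).le_opNorm v) hξ) s
  have hf := hfext.1
  refine ⟨GNS hf, inferInstance, inferInstance, inferInstance,
    gns hf, isIrreducible_of_vectorState_mem_extremePoints (norm_gns_apply_le hf)
      (norm_gns_one hf) (denseRange_gns_one hf) (by rwa [vectorState_gns_one]), fun h0 => ?_⟩
  rw [← vectorState_gns_one hf, re_vectorState_star_mul_self, re_vectorState_star_mul_self, h0]
    at hle
  simp at hle
  exact hsξ hle

/-- The pull-back of a unitary representation of `A / Jac(A)` to `A`. -/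
def ofJacobsonQuotient {A : Type u} [Ring A] [StarRing A] [Algebra ℂ A]
    {H : Type v} [NormedAddCommGroup H] [InnerProductSpace ℂ H]
    (π : UnitaryRep (A ⧸ Ring.jacobson A) H) : UnitaryRep A H where
  toHom := π.toHom.comp (Ideal.Quotient.mkₐ ℂ (Ring.jacobson A))
  inner_map_left a x y := π.inner_map_left (Ideal.Quotient.mk _ a) x y

end UnitaryRep

/-- Testing irreducible representations in the universe of `A` suffices, since a GNS space is a
completion of `A` with a seminorm. -/
theorem isPolynomialIdentity_of_rank_le {A : Type u} [Ring A] [StarRing A] [Algebra ℂ A]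
    [StarModule ℂ A] {n : ℕ} {H : Type w} [NormedAddCommGroup H] [InnerProductSpace ℂ H]
    [CompleteSpace H] {π : UnitaryRep (A ⧸ Ring.jacobson A) H} (hπ : π.IsFaithful)
    (h : ∀ (V : Type u) [NormedAddCommGroup V] [InnerProductSpace ℂ V] [CompleteSpace V]
      (ρ : UnitaryRep A V), ρ.IsIrreducible → Module.rank ℂ V ≤ n) :
    IsPolynomialIdentity (standardPolynomial (2 * n)) (A ⧸ Ring.jacobson A) := by
  intro x
  choose y hy using fun i => Ideal.Quotient.mk_surjective (x i)
  rw [← funext hy, ← map_lift_standardPolynomial]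
  by_contra hne
  have hs : π.ofJacobsonQuotient.toHom (FreeAlgebra.lift ℤ y (standardPolynomial (2 * n))) ≠ 0 :=
    fun h0 => hne (hπ (h0.trans (map_zero _).symm))
  obtain ⟨V, _, _, _, ρ, hρ, hρs⟩ := π.ofJacobsonQuotient.exists_isIrreducible_toHom_ne_zero hs
  refine hρs ((map_lift_standardPolynomial (ρ.toHom : A →+* Module.End ℂ V) y).trans ?_)
  exact isPolynomialIdentity_standardPolynomial_end (h V ρ hρ) _

theorem mainTheorem4 (A : Type u) [Ring A] [StarRing A] [Algebra ℂ A] [StarModule ℂ A] (n : ℕ) :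
    (IsPolynomialIdentity (standardPolynomial (2 * n)) (A ⧸ Ring.jacobson A) →
      ∀ (V : Type v) [NormedAddCommGroup V] [InnerProductSpace ℂ V] [CompleteSpace V]
        (ρ : UnitaryRep A V), ρ.IsIrreducible → Module.rank ℂ V ≤ n) ∧
    ((∃ (H : Type w) (_ : NormedAddCommGroup H) (_ : InnerProductSpace ℂ H)
        (_ : CompleteSpace H) (π : UnitaryRep (A ⧸ Ring.jacobson A) H), π.IsFaithful) →
      (∀ (V : Type u) [NormedAddCommGroup V] [InnerProductSpace ℂ V] [CompleteSpace V]
        (ρ : UnitaryRep A V), ρ.IsIrreducible → Module.rank ℂ V ≤ n) →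
      IsPolynomialIdentity (standardPolynomial (2 * n)) (A ⧸ Ring.jacobson A)) := by
  refine ⟨fun h V _ _ _ ρ hρ => hρ.rank_le h, ?_⟩
  rintro ⟨H, _, _, _, π, hπ⟩ h
  exact isPolynomialIdentity_of_rank_le hπ h
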